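/- For complex numbers $\mu_1,\dots,\mu_r$ ($r\ge 0$) let $E_{(\mu_1,\dots,\mu_r)}$ be the space of all $f\in C^\infty(\mathbb R,\mathbb C)$ with $\left(\frac{d}{dx}-\mu_1\right)\cdots\left(\frac{d}{dx}-\mu_r\right)f=0$. For real $a<b$ and $r\ge 1$, the Bernstein basis of this space with respect to $a,b$ is the system $p_{(\mu_1,\dots,\mu_r),k}\in E_{(\mu_1,\dots,\mu_r)}$, $k=0,\dots,r-1$, such that $p_{(\mu_1,\dots,\mu_r),k}$ has a zero of order exactly $k$ at $a$ and a zero of order exactly $r-1-k$ at $b$, normalized by $p^{(k)}_{(\mu_1,\dots,\mu_r),k}(a)=1$. Theorem. Let $n\ge 1$ and $\lambda_2,\dots,\lambda_n\in\mathbb C$ be such that $E_{(\lambda_2,\dots,\lambda_n)}$ is closed under complex conjugation ($f\in E$ implies $\overline f\in E$), and put $M_n=\max\{|\operatorname{Im}\lambda_j| : j=2,\dots,n\}$ (with $M_n=0$ if $n=1$). Let $a,b\in\mathbb R$ with $0<b-a<\pi/M_n$, where the upper bound is read as $+\infty$ if $M_n=0$. Then for every real $\lambda$ the space $E_{(\lambda,\lambda_2,\dots,\lambda_n)}$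 has a unique Bernstein basis with respect to $a,b$, and for every $k\in\{0,\dots,n-1\}$ the following hold. 1. For all real $\lambda_0<\lambda_1$ the limit below exists, is real, and satisfies $$\lim_{x\to b}\frac{p_{(\lambda_0,\lambda_2,\dots,\lambda_n),k}(x)}{p_{(\lambda_1,\lambda_2,\dots,\lambda_n),k}(x)}<1.$$ 2. For each $x\in(a,b)$ the values $p_{(\lambda,\lambda_2,\dots,\lambda_n),k}(x)$, $\lambda\in\mathbb R$, are real, and the function $\lambda\mapsto p_{(\lambda,\lambda_2,\dots,\lambda_n),k}(x)$ is strictly increasing on $\mathbb R$. -/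

import Mathlib

open scoped ContDiff Topology

/-- The differential operator `(d/dx - Λ 0) ∘ ⋯ ∘ (d/dx - Λ (m-1))` acting on functions `ℝ → ℂ`;
for `m = 0` it is the identity. -/
noncomputable def expDiffOp {m : ℕ} (Λ : Fin m → ℂ) (f : ℝ → ℂ) : ℝ → ℂ :=
  (List.ofFn Λ).foldr (fun c g x => deriv g x - c * g x) f

/-- The space `E_Λ` of exponential polynomials: the smooth functions `f : ℝ → ℂ` such that
`f` is annihilated by the differential operator with eigenvalues `Λ`. -/
def expPolySpace {m : ℕ} (Λ : Fin m → ℂ) : Set (ℝ → ℂ) :=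
  {f | ContDiff ℝ ∞ f ∧ ∀ x, expDiffOp Λ f x = 0}

/-- A set of complex-valued functions is closed under complex conjugation. -/
def ClosedUnderConj (E : Set (ℝ → ℂ)) : Prop :=
  ∀ f ∈ E, (fun x => (starRingEnd ℂ) (f x)) ∈ E

/-- `f` has a zero of order (multiplicity) exactly `k` at `a`. -/
def HasZeroOfOrder (f : ℝ → ℂ) (k : ℕ) (a : ℝ) : Prop :=
  (∀ j < k, iteratedDeriv j f a = 0) ∧ iteratedDeriv k f a ≠ 0

/-- `p 0, …, p n` is the (normalized) Bernstein basis of `E_Λ`, `Λ = (Λ 0, …, Λ n)`, with respect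
to `a` and `b`: `p k` lies in `E_Λ`, has a zero of order `k` at `a` and a zero of order `n - k`
at `b`, and its `k`-th derivative at `a` equals `1`. -/
def IsBernsteinBasis {n : ℕ} (Λ : Fin (n + 1) → ℂ) (a b : ℝ) (p : Fin (n + 1) → ℝ → ℂ) : Prop :=
  ∀ k : Fin (n + 1), p k ∈ expPolySpace Λ ∧
    HasZeroOfOrder (p k) k a ∧ HasZeroOfOrder (p k) (n - k) b ∧
    iteratedDeriv k (p k) a = 1

open Classical in
/-- The Bernstein basis function `p_{Λ,k}` of `E_Λ` with respect to `a` and `b` (the zero function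
if there is no Bernstein basis). -/
noncomputable def bernsteinFun {n : ℕ} (Λ : Fin (n + 1) → ℂ) (a b : ℝ) (k : Fin (n + 1)) :
    ℝ → ℂ :=
  if h : ∃ p, IsBernsteinBasis Λ a b p then h.choose k else 0

/-- `max_j |Im (Λ j)|`, which is `0` for the empty tuple. -/
noncomputable def maxAbsIm {m : ℕ} (Λ : Fin m → ℂ) : ℝ := ⨆ j, |(Λ j).im|

/-!
Write `Q` for the product of the `X - λⱼ`, `j ≥ 2`. It has real coefficients because `E_Q` is closed
under conjugation. The difference `u = p_{λ₁,k} - p_{λ₀,k}` of two Bernstein functions satisfies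
`(D - λ₀) Q(D) u = (λ₁ - λ₀) Q(D) p_{λ₁,k}`, and `Q(D) p_{λ₁,k}` is a multiple of `exp (λ₁ x)`,
hence of constant sign.

Signs are transferred between functions and their derivatives by Rolle's theorem: if `φ` has `k`
zeros at `a` and `l` zeros at `b`, then a value of `φ` inside `(a, b)` forces `D^(k+l) φ` to take a
value of the same sign up to the factor `(-1)^l`. This carries over from `D^(k+l)` to any `P(D)` of
degree `k + l` that is composed of operators `φ ↦ v D(φ / w)` with `v, w > 0` on `[a, b]`. A real
root `c` of `P` contributes one such operator, with `w = exp (c x)`; a pair `α ± iβ` contributes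
two, built from the solution `exp (α x) cos (β (x - (a + b) / 2))`, which is positive on `[a, b]`
because `|β| (b - a) < π`.

Since `u` has `k + 1` zeros at `a` and `n - 1 - k` at `b`, the function `u` is positive on `(a, b)`
and its first possibly nonzero derivative at `b` has the corresponding strict sign. The quotient of
these derivatives of `p_{λ₀,k}` and `p_{λ₁,k}` is the limit in question.
-/

open Polynomial Set Filter

/-- `Alternates K a φ r τ y` says that there are points `a < x₀ < ⋯ < x_r = y` at which `φ`
alternates in sign, where `τ` is the sign at `y` and membership in `K` stands for positivity:
taking `K` to be the open or the closed half line yields strict and weak alternation. -/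
inductive Alternates (K : ConvexCone ℝ ℝ) (a : ℝ) (φ : ℝ → ℝ) : ℕ → ℝ → ℝ → Prop
  | single {τ y : ℝ} : a < y → τ * φ y ∈ K → Alternates K a φ 0 τ y
  | snoc {r : ℕ} {τ y z : ℝ} : Alternates K a φ r τ y → y < z → -τ * φ z ∈ K →
      Alternates K a φ (r + 1) (-τ) z

/-- A sign pattern of `φ` on `(a, b)` which, together with zeros of multiplicity `k` at `a` and `l`
at `b`, forces an `n`-th order derivative of `φ` to take a value of sign `σ` on `(a, b)`. -/
def SignPattern (K : ConvexCone ℝ ℝ) (a b : ℝ) (φ : ℝ → ℝ) (n k l : ℕ) (σ : ℝ) : Prop :=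
  ∃ r τ y, k + l + r = n ∧ τ * (-1) ^ l = σ ∧ y < b ∧ Alternates K a φ r τ y

section Rolle

variable {K : ConvexCone ℝ ℝ} {a b y z τ σ : ℝ} {φ φ' φ'' ψ w w' : ℝ → ℝ} {r n k l : ℕ}

lemma mul_mul_mem_of_pos {c t : ℝ} (hc : 0 < c) (h : τ * t ∈ K) : τ * (c * t) ∈ K := by
  rw [mul_left_comm]
  exact K.smul_mem hc h

lemma exists_mul_deriv_mem (hyz : y < z) (hφ : ∀ x ∈ Icc y z, HasDerivAt φ (φ' x) x)
    (h : τ * (φ z - φ y) ∈ K) : ∃ ξ ∈ Ioo y z, τ * φ' ξ ∈ K := by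
  obtain ⟨ξ, hξ, hslope⟩ := exists_hasDerivAt_eq_slope φ φ' hyz
    (fun x hx => (hφ x hx).continuousAt.continuousWithinAt)
    (fun x hx => hφ x (Ioo_subset_Icc_self hx))
  refine ⟨ξ, hξ, ?_⟩
  rw [hslope, div_eq_inv_mul]
  exact mul_mul_mem_of_pos (inv_pos.2 (sub_pos.2 hyz)) h

namespace Alternates

lemma left_lt (h : Alternates K a φ r τ y) : a < y := by
  induction h with
  | single hay _ => exact hay
  | snoc _ hyz _ ih => exact ih.trans hyz

lemma mul_mem (h : Alternates K a φ r τ y) : τ * φ y ∈ K := by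
  cases h <;> assumption

lemma of_eq_pos_mul (h : Alternates K a φ r τ y) (hy : y < b)
    (hψ : ∀ x ∈ Ioo a b, ∃ c > 0, ψ x = c * φ x) : Alternates K a ψ r τ y := by
  have hmem {τ x} (hx : x ∈ Ioo a b) (h : τ * φ x ∈ K) : τ * ψ x ∈ K := by
    obtain ⟨c, hc, hcx⟩ := hψ x hx
    exact hcx ▸ mul_mul_mem_of_pos hc h
  induction h with
  | single hay hτ => exact single hay (hmem ⟨hay, hy⟩ hτ)
  | snoc h hyz hτ ih =>
    exact snoc (ih (hyz.trans hy)) hyz (hmem ⟨h.left_lt.trans hyz, hy⟩ hτ)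

lemma exists_deriv_mem (h : Alternates K a φ r τ y)
    (hφ : ∀ x ∈ Icc a b, HasDerivAt φ (φ' x) x) (hyz : y < z) (hzb : z ≤ b)
    (hz : -τ * φ z ∈ K ∨ φ z = 0) : ∃ ξ ∈ Ioo y z, -τ * φ' ξ ∈ K := by
  refine exists_mul_deriv_mem hyz (fun x hx => hφ x ⟨h.left_lt.le.trans hx.1, hx.2.trans hzb⟩) ?_
  rcases hz with hz | hz
  · convert K.add_mem h.mul_mem hz using 1
    ring
  · convert h.mul_mem using 1
    rw [hz]
    ring

lemma deriv_of_eq_zero (h : Alternates K a φ r τ y)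
    (hφ : ∀ x ∈ Icc a b, HasDerivAt φ (φ' x) x) (ha : φ a = 0) (hy : y < b) :
    ∃ z < y, Alternates K a φ' r τ z := by
  induction h with
  | single hay hτ =>
    obtain ⟨ξ, hξ, hξτ⟩ := exists_mul_deriv_mem hay (fun x hx => hφ x ⟨hx.1, hx.2.trans hy.le⟩)
      (by rwa [ha, sub_zero])
    exact ⟨ξ, hξ.2, single hξ.1 hξτ⟩
  | snoc h hyz hz ih =>
    obtain ⟨x, hxy, hx⟩ := ih (hyz.trans hy)
    obtain ⟨ξ, hξ, hξτ⟩ := h.exists_deriv_mem hφ hyz hy.le (.inl hz)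
    exact ⟨ξ, hξ.2, snoc hx (hxy.trans hξ.1) hξτ⟩

lemma deriv_of_succ (h : Alternates K a φ (r + 1) τ y)
    (hφ : ∀ x ∈ Icc a b, HasDerivAt φ (φ' x) x) (hy : y < b) :
    ∃ z < y, Alternates K a φ' r τ z := by
  induction r generalizing τ y with
  | zero =>
    obtain _ | ⟨h, hyz, hz⟩ := h
    obtain ⟨ξ, hξ, hξτ⟩ := h.exists_deriv_mem hφ hyz hy.le (.inl hz)
    exact ⟨ξ, hξ.2, single (h.left_lt.trans hξ.1) hξτ⟩
  | succ r ih =>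
    obtain _ | ⟨h, hyz, hz⟩ := h
    obtain ⟨x, hxy, hx⟩ := ih h (hyz.trans hy)
    obtain ⟨ξ, hξ, hξτ⟩ := h.exists_deriv_mem hφ hyz hy.le (.inl hz)
    exact ⟨ξ, hξ.2, snoc hx (hxy.trans hξ.1) hξτ⟩

end Alternates

namespace SignPattern

lemma of_mem {x : ℝ} (hx : x ∈ Ioo a b) (hτ : τ * φ x ∈ K) :
    SignPattern K a b φ (k + l) k l (τ * (-1) ^ l) :=
  ⟨0, τ, x, rfl, rfl, hx.2, .single hx.1 hτ⟩

lemma exists_mem (h : SignPattern K a b φ 0 k l σ) : ∃ ξ ∈ Ioo a b, σ * φ ξ ∈ K := by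
  obtain ⟨r, τ, y, hn, rfl, hyb, h⟩ := h
  obtain rfl : l = 0 := by omega
  exact ⟨y, ⟨h.left_lt, hyb⟩, by simpa using h.mul_mem⟩

lemma of_eq_pos_mul (h : SignPattern K a b φ n k l σ)
    (hψ : ∀ x ∈ Ioo a b, ∃ c > 0, ψ x = c * φ x) : SignPattern K a b ψ n k l σ := by
  obtain ⟨r, τ, y, hn, hσ, hyb, h⟩ := h
  exact ⟨r, τ, y, hn, hσ, hyb, h.of_eq_pos_mul hyb hψ⟩

lemma deriv (h : SignPattern K a b φ (n + 1) k l σ)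
    (hφ : ∀ x ∈ Icc a b, HasDerivAt φ (φ' x) x) (ha : 0 < k → φ a = 0) (hb : 0 < l → φ b = 0) :
    SignPattern K a b φ' n (k - 1) (l - 1) σ := by
  obtain ⟨r, τ, y, hn, rfl, hyb, h⟩ := h
  have hright (hl : 0 < l) : ∃ ξ ∈ Ioo y b, -τ * φ' ξ ∈ K :=
    h.exists_deriv_mem hφ hyb le_rfl (.inr (hb hl))
  have hsign (j : ℕ) : -τ * (-1) ^ j = τ * (-1) ^ (j + 1) := by ring
  obtain rfl | hk := Nat.eq_zero_or_pos k
  · obtain _ | l := l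
    · obtain ⟨r, rfl⟩ : ∃ s, r = s + 1 := ⟨n, by omega⟩
      obtain ⟨z, hzy, hz⟩ := h.deriv_of_succ hφ hyb
      exact ⟨r, τ, z, by omega, rfl, hzy.trans hyb, hz⟩
    · obtain ⟨ξ, hξ, hξτ⟩ := hright l.succ_pos
      obtain _ | r := r
      · exact ⟨0, -τ, ξ, by omega, hsign l, hξ.2, .single (h.left_lt.trans hξ.1) hξτ⟩
      · obtain ⟨z, hzy, hz⟩ := h.deriv_of_succ hφ hyb
        exact ⟨r + 1, -τ, ξ, by omega, hsign l, hξ.2, .snoc hz (hzy.trans hξ.1) hξτ⟩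
  · obtain ⟨z, hzy, hz⟩ := h.deriv_of_eq_zero hφ (ha hk) hyb
    obtain _ | l := l
    · exact ⟨r, τ, z, by omega, rfl, hzy.trans hyb, hz⟩
    · obtain ⟨ξ, hξ, hξτ⟩ := hright l.succ_pos
      exact ⟨r + 1, -τ, ξ, by omega, hsign l, hξ.2, .snoc hz (hzy.trans hξ.1) hξτ⟩

lemma wronskian (h : SignPattern K a b φ (n + 1) k l σ)
    (hφ : ∀ x ∈ Icc a b, HasDerivAt φ (φ' x) x) (hw : ∀ x ∈ Icc a b, HasDerivAt w (w' x) x)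
    (hpos : ∀ x ∈ Icc a b, 0 < w x) (ha : 0 < k → φ a = 0) (hb : 0 < l → φ b = 0) :
    SignPattern K a b (fun x => φ' x * w x - φ x * w' x) n (k - 1) (l - 1) σ := by
  have hdiv : SignPattern K a b (fun x => φ x / w x) (n + 1) k l σ :=
    h.of_eq_pos_mul fun x hx =>
      ⟨(w x)⁻¹, inv_pos.2 (hpos x (Ioo_subset_Icc_self hx)), div_eq_inv_mul _ _⟩
  refine (hdiv.deriv (fun x hx => (hφ x hx).div (hw x hx) (hpos x hx).ne')
    (fun hk => by rw [ha hk, zero_div]) (fun hl => by rw [hb hl, zero_div])).of_eq_pos_mul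
    fun x hx => ?_
  have hwx := hpos x (Ioo_subset_Icc_self hx)
  exact ⟨w x ^ 2, by positivity, by field_simp⟩

lemma deriv_sub_mul (c : ℝ) (h : SignPattern K a b φ (n + 1) k l σ)
    (hφ : ∀ x ∈ Icc a b, HasDerivAt φ (φ' x) x) (ha : 0 < k → φ a = 0) (hb : 0 < l → φ b = 0) :
    SignPattern K a b (fun x => φ' x - c * φ x) n (k - 1) (l - 1) σ := by
  have hexp (x : ℝ) : HasDerivAt (fun x => Real.exp (c * x)) (Real.exp (c * x) * (c * 1)) x :=
    ((hasDerivAt_id x).const_mul c).exp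
  refine (h.wronskian hφ (fun x _ => hexp x) (fun x _ => Real.exp_pos _) ha hb).of_eq_pos_mul
    fun x _ => ⟨Real.exp (-(c * x)), Real.exp_pos _, ?_⟩
  rw [Real.exp_neg]
  field_simp

end SignPattern

lemma exists_pos_quadratic_solution {α β : ℝ} (hβ : |β| * (b - a) < Real.pi) :
    ∃ w w' : ℝ → ℝ, (∀ x ∈ Icc a b, 0 < w x) ∧ (∀ x, HasDerivAt w (w' x) x) ∧
      ∀ x, HasDerivAt w' (2 * α * w' x - (α ^ 2 + β ^ 2) * w x) x := by
  set e : ℝ → ℝ := fun x => Real.exp (α * x)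
  set c : ℝ → ℝ := fun x => Real.cos (β * (x - (a + b) / 2))
  set s : ℝ → ℝ := fun x => Real.sin (β * (x - (a + b) / 2))
  have he (x : ℝ) : HasDerivAt e (α * e x) x :=
    ((hasDerivAt_id x).const_mul α).exp.congr_deriv (by simp only [e, id]; ring)
  have hc (x : ℝ) : HasDerivAt c (-β * s x) x :=
    (((hasDerivAt_id x).sub_const _).const_mul β).cos.congr_deriv (by simp only [s, id]; ring)
  have hs (x : ℝ) : HasDerivAt s (β * c x) x :=
    (((hasDerivAt_id x).sub_const _).const_mul β).sin.congr_deriv (by simp only [c, id]; ring)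
  refine ⟨fun x => e x * c x, fun x => e x * (α * c x - β * s x), fun x hx => ?_, fun x => ?_,
    fun x => ?_⟩
  · refine mul_pos (Real.exp_pos _) (Real.cos_pos_of_mem_Ioo (abs_lt.1 ?_))
    have hdist : |x - (a + b) / 2| ≤ (b - a) / 2 :=
      abs_le.2 ⟨by linarith [hx.1], by linarith [hx.2]⟩
    rw [abs_mul]
    linarith [mul_le_mul_of_nonneg_left hdist (abs_nonneg β)]
  · exact ((he x).mul (hc x)).congr_deriv (by ring)
  · exact ((he x).mul (((hc x).const_mul α).sub ((hs x).const_mul β))).congr_deriv (by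
      simp only [Pi.sub_apply]; ring)

lemma SignPattern.deriv_deriv_sub_mul {α β : ℝ} (hβ : |β| * (b - a) < Real.pi)
    (h : SignPattern K a b φ (n + 2) k l σ)
    (hφ : ∀ x ∈ Icc a b, HasDerivAt φ (φ' x) x) (hφ' : ∀ x ∈ Icc a b, HasDerivAt φ' (φ'' x) x)
    (ha : 0 < k → φ a = 0) (ha' : 1 < k → φ' a = 0)
    (hb : 0 < l → φ b = 0) (hb' : 1 < l → φ' b = 0) :
    SignPattern K a b (fun x => φ'' x - 2 * α * φ' x + (α ^ 2 + β ^ 2) * φ x)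
      n (k - 2) (l - 2) σ := by
  obtain ⟨w, w', hpos, hw, hw'⟩ := exists_pos_quadratic_solution (α := α) hβ
  set W : ℝ → ℝ := fun x => φ' x * w x - φ x * w' x with hWdef
  have hW : SignPattern K a b W (n + 1) (k - 1) (l - 1) σ :=
    h.wronskian hφ (fun x _ => hw x) hpos ha hb
  have hzero {x : ℝ} {i : ℕ} (h₀ : 0 < i → φ x = 0) (h₁ : 1 < i → φ' x = 0) (hi : 0 < i - 1) :
      W x = 0 := by
    simp [hWdef, h₀ (by omega), h₁ (by omega)]
  refine (hW.deriv_sub_mul (2 * α) (fun x hx => ((hφ' x hx).mul (hw x)).sub ((hφ x hx).mul (hw' x)))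
    (hzero ha ha') (hzero hb hb')).of_eq_pos_mul fun x hx => ?_
  have hwx := hpos x (Ioo_subset_Icc_self hx)
  exact ⟨(w x)⁻¹, inv_pos.2 hwx, by simp only [hWdef]; field_simp; ring⟩

end Rolle

/-- The space of smooth functions on the real line with values in `𝕜`. -/
def smoothFun (𝕜 : Type*) [RCLike 𝕜] : Submodule 𝕜 (ℝ → 𝕜) where
  carrier := {f | ContDiff ℝ ∞ f}
  add_mem' {f g} (hf : ContDiff ℝ ∞ f) (hg : ContDiff ℝ ∞ g) := hf.add hg
  zero_mem' := (contDiff_const : ContDiff ℝ ∞ fun _ : ℝ => (0 : 𝕜))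
  smul_mem' _ f (hf : ContDiff ℝ ∞ f) := contDiff_const.smul hf

namespace smoothFun

variable {𝕜 𝕜' : Type*} [RCLike 𝕜] [RCLike 𝕜'] {F : smoothFun 𝕜} {a x : ℝ} {n k : ℕ}

instance : CoeFun (smoothFun 𝕜) fun _ => ℝ → 𝕜 := ⟨Subtype.val⟩

lemma contDiff (F : smoothFun 𝕜) : ContDiff ℝ ∞ F := F.2

lemma differentiableAt (F : smoothFun 𝕜) (x : ℝ) : DifferentiableAt ℝ F x :=
  (contDiff F).differentiable (by simp) x

/-- Differentiation as an endomorphism of the space of smooth functions, so that a differential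
operator with constant coefficients is `aeval derivOp P` for its characteristic polynomial `P`. -/
noncomputable def derivOp : Module.End 𝕜 (smoothFun 𝕜) where
  toFun F := ⟨deriv F, (contDiff_infty_iff_deriv.1 (contDiff F)).2⟩
  map_add' F G := Subtype.ext <| funext fun x =>
    deriv_add (differentiableAt F x) (differentiableAt G x)
  map_smul' c F := Subtype.ext <| funext fun x =>
    deriv_const_smul c (differentiableAt F x)

lemma hasDerivAt (F : smoothFun 𝕜) (x : ℝ) : HasDerivAt F (derivOp F x) x :=
  (differentiableAt F x).hasDerivAt

lemma derivOp_pow_succ (j : ℕ) (F : smoothFun 𝕜) :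
    (derivOp ^ (j + 1)) F = (derivOp ^ j) (derivOp F) := by
  rw [pow_succ, Module.End.mul_apply]

lemma derivOp_pow_succ' (j : ℕ) (F : smoothFun 𝕜) :
    (derivOp ^ (j + 1)) F = derivOp ((derivOp ^ j) F) := by
  rw [pow_succ', Module.End.mul_apply]

lemma derivOp_pow_apply (j : ℕ) (F : smoothFun 𝕜) :
    ((derivOp ^ j) F : ℝ → 𝕜) = iteratedDeriv j F := by
  induction j with
  | zero => simp
  | succ j ih =>
    rw [derivOp_pow_succ', iteratedDeriv_succ, ← ih]
    rfl

lemma aeval_X_sub_C (c : 𝕜) : aeval (derivOp (𝕜 := 𝕜)) (X - C c) = derivOp - c • 1 := by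
  simp [Algebra.algebraMap_eq_smul_one]

lemma aeval_mul_apply {R : Type*} [CommSemiring R] [Algebra R (Module.End 𝕜 (smoothFun 𝕜))]
    (P Q : R[X]) (F : smoothFun 𝕜) :
    aeval derivOp (P * Q) F = aeval derivOp P (aeval derivOp Q F) := by
  rw [map_mul, Module.End.mul_apply]

/-- The values at `a` of the derivatives of order less than `n`. -/
noncomputable def jet (n : ℕ) (a : ℝ) : smoothFun 𝕜 →ₗ[𝕜] (Fin n → 𝕜) :=
  LinearMap.pi fun j => LinearMap.proj a ∘ₗ (smoothFun 𝕜).subtype ∘ₗ derivOp ^ (j : ℕ)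

/-- The smooth functions with a zero of multiplicity at least `n` at `a`. -/
noncomputable def vanishing (𝕜 : Type*) [RCLike 𝕜] (n : ℕ) (a : ℝ) : Submodule 𝕜 (smoothFun 𝕜) :=
  LinearMap.ker (jet n a)

lemma mem_vanishing : F ∈ vanishing 𝕜 n a ↔ ∀ j < n, (derivOp ^ j) F a = 0 :=
  ⟨fun h j hj => congrFun h ⟨j, hj⟩, fun h => funext fun j => h j j.2⟩

lemma vanishing_anti (h : k ≤ n) : vanishing 𝕜 n a ≤ vanishing 𝕜 k a := fun _ hF =>
  mem_vanishing.2 fun j hj => mem_vanishing.1 hF j (hj.trans_le h)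

lemma apply_eq_zero_of_mem_vanishing (h : F ∈ vanishing 𝕜 n a) (hn : 0 < n) : F a = 0 :=
  mem_vanishing.1 h 0 hn

lemma mem_vanishing_succ :
    F ∈ vanishing 𝕜 (n + 1) a ↔ F ∈ vanishing 𝕜 n a ∧ (derivOp ^ n) F a = 0 := by
  simp only [mem_vanishing, Nat.forall_lt_succ_right]

lemma derivOp_mem_vanishing (h : F ∈ vanishing 𝕜 n a) : derivOp F ∈ vanishing 𝕜 (n - 1) a :=
  mem_vanishing.2 fun j hj => derivOp_pow_succ j F ▸ mem_vanishing.1 h (j + 1) (by omega)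

lemma derivOp_pow_mem_vanishing (h : F ∈ vanishing 𝕜 n a) (j : ℕ) :
    (derivOp ^ j) F ∈ vanishing 𝕜 (n - j) a := by
  induction j with
  | zero => exact h
  | succ j ih => exact derivOp_pow_succ' j F ▸ derivOp_mem_vanishing ih

lemma aeval_mem_vanishing (P : 𝕜[X]) (h : F ∈ vanishing 𝕜 n a) :
    aeval derivOp P F ∈ vanishing 𝕜 (n - P.natDegree) a := by
  rw [aeval_eq_sum_range, LinearMap.sum_apply]
  refine Submodule.sum_mem _ fun j hj => Submodule.smul_mem _ _ ?_
  rw [Finset.mem_range_succ_iff] at hj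
  exact vanishing_anti (Nat.sub_le_sub_left hj n) (derivOp_pow_mem_vanishing h j)

lemma mem_vanishing_of_eqOn_zero {U : Set ℝ} (hU : IsOpen U) (h : EqOn F 0 U) (hx : x ∈ U)
    (n : ℕ) : F ∈ vanishing 𝕜 n x := by
  have hderiv (j : ℕ) : EqOn ((derivOp ^ j) F) 0 U := by
    induction j with
    | zero => exact h
    | succ j ih =>
      intro y hy
      rw [derivOp_pow_succ']
      exact ((ih.eventuallyEq_of_mem (hU.mem_nhds hy)).deriv_eq).trans (deriv_const y 0)
  exact mem_vanishing.2 fun j _ => hderiv j hx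

/-- Composition of smooth functions with a real linear map of the values. -/
noncomputable def postcomp (L : 𝕜 →L[ℝ] 𝕜') : smoothFun 𝕜 →ₗ[ℝ] smoothFun 𝕜' where
  toFun F := ⟨fun x => L (F x), L.contDiff.comp (contDiff F)⟩
  map_add' F G := Subtype.ext <| funext fun x => map_add L (F x) (G x)
  map_smul' c F := Subtype.ext <| funext fun x => map_smul L c (F x)

variable (L : 𝕜 →L[ℝ] 𝕜')

lemma postcomp_apply (F : smoothFun 𝕜) (x : ℝ) : postcomp L F x = L (F x) := rfl

lemma derivOp_postcomp (F : smoothFun 𝕜) : derivOp (postcomp L F) = postcomp L (derivOp F) :=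
  Subtype.ext <| funext fun x => (L.hasFDerivAt.comp_hasDerivAt x (hasDerivAt F x)).deriv

lemma derivOp_pow_postcomp (j : ℕ) (F : smoothFun 𝕜) :
    (derivOp ^ j) (postcomp L F) = postcomp L ((derivOp ^ j) F) := by
  induction j with
  | zero => rfl
  | succ j ih => rw [derivOp_pow_succ', ih, derivOp_postcomp, derivOp_pow_succ']

lemma aeval_postcomp (P : ℝ[X]) (F : smoothFun 𝕜) :
    aeval derivOp P (postcomp L F) = postcomp L (aeval derivOp P F) := by
  simp only [aeval_eq_sum_range, LinearMap.sum_apply, LinearMap.smul_apply, map_sum, map_smul,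
    derivOp_pow_postcomp]

lemma postcomp_mem_vanishing (h : F ∈ vanishing 𝕜 n a) : postcomp L F ∈ vanishing 𝕜' n a :=
  mem_vanishing.2 fun j hj => by
    rw [derivOp_pow_postcomp, postcomp_apply, mem_vanishing.1 h j hj, map_zero]

end smoothFun

section InitialValue

open smoothFun

variable {𝕜 : Type*} [RCLike 𝕜] {F : smoothFun 𝕜} {P R : 𝕜[X]} {a b : ℝ} {k l : ℕ}

lemma splits_induction {R : Type*} [Field R] {p : R[X] → Prop} (const : ∀ c ≠ 0, p (C c))
    (mul : ∀ c Q, Q ≠ 0 → p Q → p ((X - C c) * Q)) {P : R[X]} (hP : P.Splits) (hP₀ : P ≠ 0) :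
    p P := by
  obtain ⟨s, hs⟩ := splits_iff_exists_multiset.1 hP
  generalize P.leadingCoeff = d at hs
  clear hP
  subst hs
  induction s using Multiset.induction with
  | empty => simpa using const d (by simpa using hP₀)
  | cons c s ih =>
    rw [Multiset.map_cons, Multiset.prod_cons, mul_left_comm] at hP₀ ⊢
    exact mul c _ (right_ne_zero_of_mul hP₀) (ih (right_ne_zero_of_mul hP₀))

lemma aeval_X_sub_C_mul_apply (c : 𝕜) (P : 𝕜[X]) (F : smoothFun 𝕜) :
    aeval derivOp ((X - C c) * P) F = aeval derivOp P (derivOp F - c • F) := by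
  rw [mul_comm, aeval_mul_apply, aeval_X_sub_C]
  rfl

lemma aeval_X_sub_C_mul_apply' (c : 𝕜) (P : 𝕜[X]) (F : smoothFun 𝕜) :
    aeval derivOp ((X - C c) * P) F = derivOp (aeval derivOp P F) - c • aeval derivOp P F := by
  rw [aeval_mul_apply, aeval_X_sub_C]
  rfl

lemma natDegree_X_sub_C_mul {R : Type*} [CommRing R] [IsDomain R] {P : R[X]} (c : R)
    (hP : P ≠ 0) : ((X - C c) * P).natDegree = P.natDegree + 1 := by
  rw [natDegree_mul (X_sub_C_ne_zero c) hP, natDegree_X_sub_C, add_comm]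

/-- The exponential function with exponent `c`. -/
noncomputable def expFun (c : 𝕜) : smoothFun 𝕜 :=
  ⟨fun x => NormedSpace.exp (x • c), by
    have hexp : ContDiff ℝ ∞ (NormedSpace.exp : 𝕜 → 𝕜) :=
      AnalyticOnNhd.contDiff (𝕜 := ℝ) fun x _ => NormedSpace.exp_analytic x
    exact hexp.comp (contDiff_id.smul contDiff_const)⟩

lemma derivOp_expFun (c : 𝕜) : derivOp (expFun c) = c • expFun c :=
  Subtype.ext <| funext fun x => (hasDerivAt_exp_smul_const' c x).deriv

lemma expFun_apply_mul (c : 𝕜) (x y : ℝ) : expFun c x * expFun c y = expFun c (x + y) := by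
  simp only [expFun, add_smul]
  exact (NormedSpace.exp_add ..).symm

lemma expFun_apply_zero (c : 𝕜) : expFun c 0 = 1 := by
  simp [expFun]

lemma hasDerivAt_expFun_neg (c : 𝕜) (x : ℝ) :
    HasDerivAt (fun x => expFun c (-x)) (-c * expFun c (-x)) x := by
  have h := (hasDerivAt (expFun c) (-x)).scomp x (hasDerivAt_neg x)
  rw [derivOp_expFun] at h
  exact h.congr_deriv (by simp)

lemma apply_eq_of_derivOp_eq_smul {c : 𝕜} (h : derivOp F = c • F) (x y : ℝ) :
    F x = expFun c (x - y) * F y := by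
  have hderiv (x : ℝ) : HasDerivAt (fun x => expFun c (-x) * F x) 0 x := by
    refine ((hasDerivAt_expFun_neg c x).mul (hasDerivAt F x)).congr_deriv ?_
    rw [h, Submodule.coe_smul, Pi.smul_apply, smul_eq_mul]
    ring
  have hconst : expFun c (-x) * F x = expFun c (-y) * F y :=
    is_const_of_deriv_eq_zero (fun x => (hderiv x).differentiableAt) (fun x => (hderiv x).deriv) x y
  rw [sub_eq_add_neg, ← expFun_apply_mul, mul_assoc, ← hconst, ← mul_assoc, expFun_apply_mul,
    add_neg_cancel, expFun_apply_zero, one_mul]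

lemma exists_derivOp_sub_smul_eq (c v : 𝕜) (G : smoothFun 𝕜) (a : ℝ) :
    ∃ F : smoothFun 𝕜, derivOp F - c • F = G ∧ F a = v := by
  set g : ℝ → 𝕜 := fun t => expFun c (-t) * G t with hg
  have hgc : ContDiff ℝ ∞ g := ((smoothFun.contDiff _).comp contDiff_neg).mul (smoothFun.contDiff G)
  set I : ℝ → 𝕜 := fun x => expFun c (-a) * v + ∫ t in a..x, g t with hI
  have hId (x : ℝ) : HasDerivAt I (g x) x :=
    (intervalIntegral.integral_hasDerivAt_right (hgc.continuous.intervalIntegrable _ _)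
      (hgc.continuous.stronglyMeasurableAtFilter _ _) hgc.continuous.continuousAt).const_add _
  have hIc : ContDiff ℝ ∞ I :=
    contDiff_infty_iff_deriv.2 ⟨fun x => (hId x).differentiableAt,
      (funext fun x => (hId x).deriv : deriv I = g) ▸ hgc⟩
  have hexp (x : ℝ) (z : 𝕜) : expFun c x * (expFun c (-x) * z) = z := by
    rw [← mul_assoc, expFun_apply_mul, add_neg_cancel, expFun_apply_zero, one_mul]
  refine ⟨⟨fun x => expFun c x * I x, (smoothFun.contDiff _).mul hIc⟩,
    Subtype.ext <| funext fun x => ?_, ?_⟩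
  · have hF : deriv (fun x => expFun c x * I x) x = c * expFun c x * I x + expFun c x * g x := by
      refine ((hasDerivAt (expFun c) x).mul (hId x)).deriv.trans ?_
      rw [derivOp_expFun]
      rfl
    change deriv (fun x => expFun c x * I x) x - c * (expFun c x * I x) = G x
    rw [hF, hg, hexp]
    ring
  · simp only [hI, intervalIntegral.integral_same, add_zero, hexp]

lemma eq_zero_of_mem_vanishing (hP : P.Splits) (hP₀ : P ≠ 0) (hF : aeval derivOp P F = 0)
    (ha : F ∈ vanishing 𝕜 P.natDegree a) : F = 0 := by
  refine splits_induction (p := fun P => ∀ F : smoothFun 𝕜, aeval derivOp P F = 0 →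
      F ∈ vanishing 𝕜 P.natDegree a → F = 0)
    (fun c hc F hF _ => ?_) (fun c Q hQ ih F hF ha => ?_) hP hP₀ F hF ha
  · simpa [hc] using hF
  · rw [aeval_X_sub_C_mul_apply] at hF
    rw [natDegree_X_sub_C_mul c hQ] at ha
    have hderiv : derivOp F = c • F := sub_eq_zero.1 <| ih _ hF <|
      Submodule.sub_mem _ (derivOp_mem_vanishing ha)
        (Submodule.smul_mem _ c (vanishing_anti (Nat.le_succ _) ha))
    refine Subtype.ext <| funext fun x => ?_
    rw [apply_eq_of_derivOp_eq_smul hderiv x a,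
      apply_eq_zero_of_mem_vanishing ha (Nat.succ_pos _), mul_zero]
    rfl

lemma exists_jet_eq (hP : P.Splits) (hP₀ : P ≠ 0) (a : ℝ) (v : ℕ → 𝕜) :
    ∃ F : smoothFun 𝕜, aeval derivOp P F = 0 ∧ ∀ j < P.natDegree, (derivOp ^ j) F a = v j := by
  refine splits_induction (p := fun P => ∀ v : ℕ → 𝕜, ∃ F : smoothFun 𝕜,
      aeval derivOp P F = 0 ∧ ∀ j < P.natDegree, (derivOp ^ j) F a = v j)
    (fun c _ v => ⟨0, map_zero _, by simp⟩) (fun c Q hQ ih v => ?_) hP hP₀ v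
  · obtain ⟨G, hG, hGv⟩ := ih fun j => v (j + 1) - c * v j
    obtain ⟨F, rfl, hFa⟩ := exists_derivOp_sub_smul_eq c (v 0) G a
    refine ⟨F, by rwa [aeval_X_sub_C_mul_apply], fun j hj => ?_⟩
    rw [natDegree_X_sub_C_mul c hQ] at hj
    induction j with
    | zero => exact hFa
    | succ j ihj =>
      have hstep : (derivOp ^ j) (derivOp F) a - c * (derivOp ^ j) F a = v (j + 1) - c * v j := by
        have h := hGv j (by omega)
        rwa [map_sub, map_smul] at h
      rw [ihj (by omega)] at hstep
      rw [derivOp_pow_succ]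
      exact sub_left_injective hstep

/-- Solutions of a homogeneous equation are parametrized by their initial values. -/
noncomputable def initialValueEquiv (hP : P.Splits) (hP₀ : P ≠ 0) (a : ℝ) :
    LinearMap.ker (aeval (derivOp (𝕜 := 𝕜)) P) ≃ₗ[𝕜] (Fin P.natDegree → 𝕜) :=
  LinearEquiv.ofBijective (jet P.natDegree a ∘ₗ Submodule.subtype _) <| by
    refine ⟨(injective_iff_map_eq_zero _).2 fun F hF =>
      Subtype.ext (eq_zero_of_mem_vanishing hP hP₀ F.2 hF), fun v => ?_⟩
    obtain ⟨F, hF, hv⟩ := exists_jet_eq hP hP₀ a fun j => if h : j < _ then v ⟨j, h⟩ else 0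
    exact ⟨⟨F, hF⟩, funext fun j => (hv j j.2).trans (dif_pos j.2)⟩

lemma natDegree_le_of_ker_le (hP : P.Splits) (hP₀ : P ≠ 0) (hR : R.Splits) (hR₀ : R ≠ 0)
    (h : LinearMap.ker (aeval (derivOp (𝕜 := 𝕜)) P) ≤ LinearMap.ker (aeval derivOp R)) :
    P.natDegree ≤ R.natDegree := by
  let eP := initialValueEquiv hP hP₀ 0
  let eR := initialValueEquiv hR hR₀ 0
  have := Module.Finite.equiv eR.symm
  simpa [eP.finrank_eq, eR.finrank_eq] using Submodule.finrank_mono h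

lemma exists_jet_eq_jet_eq (hP : P.Splits) (hP₀ : P ≠ 0) (hkl : k + l = P.natDegree)
    (hzero : ∀ F ∈ LinearMap.ker (aeval (derivOp (𝕜 := 𝕜)) P),
      F ∈ vanishing 𝕜 k a → F ∈ vanishing 𝕜 l b → F = 0) (v : Fin k → 𝕜) (w : Fin l → 𝕜) :
    ∃ F : smoothFun 𝕜, aeval derivOp P F = 0 ∧ jet k a F = v ∧ jet l b F = w := by
  let e := initialValueEquiv hP hP₀ a
  let Φ : (Fin P.natDegree → 𝕜) →ₗ[𝕜] (Fin k → 𝕜) × (Fin l → 𝕜) :=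
    ((jet k a).prod (jet l b)) ∘ₗ Submodule.subtype _ ∘ₗ e.symm.toLinearMap
  have hΦ : Function.Injective Φ := (injective_iff_map_eq_zero _).2 fun c hc =>
    e.symm.map_eq_zero_iff.1 <| Subtype.ext <|
      hzero _ (e.symm c).2 (congrArg Prod.fst hc) (congrArg Prod.snd hc)
  obtain ⟨c, hc⟩ :=
    (LinearMap.injective_iff_surjective_of_finrank_eq_finrank (by simp [hkl])).1 hΦ (v, w)
  exact ⟨e.symm c, (e.symm c).2, congrArg Prod.fst hc, congrArg Prod.snd hc⟩

end InitialValue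

section Disconjugate

open smoothFun

variable {K : ConvexCone ℝ ℝ} {a b : ℝ} {P Q : ℝ[X]} {f : smoothFun ℝ} {k l : ℕ}

/-- `P` is monic and the operator `P(d/dx)` obeys Rolle's theorem on `[a, b]` in the same signed
form as an iterated derivative. For constant coefficients this amounts to disconjugacy: no nonzero
solution of the homogeneous equation has `P.natDegree` zeros in `[a, b]`. -/
structure IsDisconjugate (a b : ℝ) (P : ℝ[X]) : Prop where
  monic : P.Monic
  signPattern : ∀ ⦃K : ConvexCone ℝ ℝ⦄ ⦃f : smoothFun ℝ⦄ ⦃n k l : ℕ⦄ ⦃σ : ℝ⦄,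
    SignPattern K a b f (n + P.natDegree) k l σ → f ∈ vanishing ℝ k a → f ∈ vanishing ℝ l b →
      SignPattern K a b (aeval derivOp P f) n (k - P.natDegree) (l - P.natDegree) σ

lemma natDegree_X_sq_sub_C_mul_X_add_C {R : Type*} [CommRing R] [Nontrivial R] (p q : R) :
    (X ^ 2 - C p * X + C q).natDegree = 2 := by
  compute_degree!

namespace IsDisconjugate

lemma one : IsDisconjugate a b 1 where
  monic := monic_one
  signPattern _ _ _ _ _ _ h _ _ := by simpa using h

lemma X_sub_C (c : ℝ) : IsDisconjugate a b (X - C c) where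
  monic := monic_X_sub_C c
  signPattern K f n k l σ h ha hb := by
    rw [natDegree_X_sub_C] at h ⊢
    convert h.deriv_sub_mul c (fun x _ => hasDerivAt f x) (apply_eq_zero_of_mem_vanishing ha)
      (apply_eq_zero_of_mem_vanishing hb) using 1
    rw [aeval_X_sub_C]
    rfl

lemma quadratic {z : ℂ} (hz : |z.im| * (b - a) < Real.pi) :
    IsDisconjugate a b (X ^ 2 - C (2 * z.re) * X + C (‖z‖ ^ 2)) where
  monic := by monicity!
  signPattern K f n k l σ h ha hb := by
    have hderiv {x : ℝ} {i : ℕ} (hi : f ∈ vanishing ℝ i x) : 1 < i → derivOp f x = 0 :=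
      mem_vanishing.1 hi 1
    rw [natDegree_X_sq_sub_C_mul_X_add_C] at h ⊢
    convert h.deriv_deriv_sub_mul (α := z.re) hz (fun x _ => hasDerivAt f x)
      (fun x _ => hasDerivAt (derivOp f) x) (apply_eq_zero_of_mem_vanishing ha) (hderiv ha)
      (apply_eq_zero_of_mem_vanishing hb) (hderiv hb) using 1
    have hnorm : ‖z‖ ^ 2 = z.re ^ 2 + z.im ^ 2 := by
      rw [← Complex.normSq_eq_norm_sq, Complex.normSq_apply]
      ring
    funext x
    simp only [hnorm, map_add, map_sub, map_mul, aeval_X, aeval_C, pow_two,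
      Algebra.algebraMap_eq_smul_one, LinearMap.add_apply, LinearMap.sub_apply,
      Module.End.mul_apply, LinearMap.smul_apply, Module.End.one_apply, Submodule.coe_add,
      Submodule.coe_sub, Submodule.coe_smul, Pi.add_apply, Pi.sub_apply, Pi.smul_apply, smul_eq_mul]
    ring

lemma mul (hP : IsDisconjugate a b P) (hQ : IsDisconjugate a b Q) :
    IsDisconjugate a b (P * Q) where
  monic := hP.monic.mul hQ.monic
  signPattern K f n k l σ h ha hb := by
    rw [hP.monic.natDegree_mul hQ.monic] at h ⊢
    rw [← add_assoc] at h
    have hvanish {x : ℝ} {i : ℕ} (hi : f ∈ vanishing ℝ i x) :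
        aeval derivOp Q f ∈ vanishing ℝ (i - Q.natDegree) x := aeval_mem_vanishing Q hi
    have := hP.signPattern (hQ.signPattern h ha hb) (hvanish ha) (hvanish hb)
    rwa [← aeval_mul_apply, Nat.sub_sub, Nat.sub_sub, add_comm Q.natDegree] at this

theorem of_abs_im_mul_lt (hP : P.Monic)
    (hroots : ∀ z : ℂ, aeval z P = 0 → |z.im| * (b - a) < Real.pi) : IsDisconjugate a b P := by
  induction hn : P.natDegree using Nat.strong_induction_on generalizing P with
  | _ n ih =>
  obtain rfl | hpos := Nat.eq_zero_or_pos n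
  · obtain rfl := hP.natDegree_eq_zero.1 hn
    exact one
  suffices hfactor : ∃ R : ℝ[X], IsDisconjugate a b R ∧ 0 < R.natDegree ∧ R ∣ P by
    obtain ⟨R, hR, hRpos, Q, rfl⟩ := hfactor
    have hQ : Q.Monic := hR.monic.of_mul_monic_left hP
    rw [hR.monic.natDegree_mul hQ] at hn
    exact hR.mul <| ih _ (by omega) hQ (fun z hz => hroots z (by rw [map_mul, hz, mul_zero])) rfl
  obtain ⟨z, hz⟩ : ∃ z : ℂ, aeval z P = 0 :=
    IsAlgClosed.exists_aeval_eq_zero _ _ (natDegree_pos_iff_degree_pos.1 (hn ▸ hpos)).ne'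
  by_cases hzi : z.im = 0
  · obtain ⟨c, rfl⟩ : ∃ c : ℝ, algebraMap ℝ ℂ c = z := ⟨z.re, Complex.ext rfl hzi.symm⟩
    refine ⟨X - C c, X_sub_C _, by simp, dvd_iff_isRoot.2 ?_⟩
    rw [aeval_algebraMap_apply] at hz
    simpa using hz
  · exact ⟨_, quadratic (hroots z hz),
      (natDegree_X_sq_sub_C_mul_X_add_C (R := ℝ) _ _).symm ▸ two_pos,
      quadratic_dvd_of_aeval_eq_zero_im_ne_zero P hz hzi⟩

lemma exists_mul_mem (hP : IsDisconjugate a b P) (hkl : k + l = P.natDegree)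
    (ha : f ∈ vanishing ℝ k a) (hb : f ∈ vanishing ℝ l b) {τ x : ℝ} (hx : x ∈ Ioo a b)
    (hτ : τ * f x ∈ K) : ∃ ξ ∈ Ioo a b, τ * (-1) ^ l * aeval derivOp P f ξ ∈ K := by
  have h : SignPattern K a b f (0 + P.natDegree) k l (τ * (-1) ^ l) := by
    rw [zero_add, ← hkl]
    exact .of_mem hx hτ
  exact (hP.signPattern h ha hb).exists_mem

end IsDisconjugate

end Disconjugate

section CharPoly

open smoothFun

variable {m : ℕ} {Λ : Fin m → ℂ}

/-- The characteristic polynomial of `expDiffOp Λ`. -/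
noncomputable def charPoly {m : ℕ} (Λ : Fin m → ℂ) : ℂ[X] := ∏ i, (X - C (Λ i))

lemma charPoly_cons (c : ℂ) (Λ : Fin m → ℂ) :
    charPoly (Fin.cons c Λ : Fin (m + 1) → ℂ) = (X - C c) * charPoly Λ := by
  simp [charPoly, Fin.prod_univ_succ]

lemma monic_charPoly (Λ : Fin m → ℂ) : (charPoly Λ).Monic :=
  monic_prod_of_monic _ _ fun _ _ => monic_X_sub_C _

lemma natDegree_charPoly (Λ : Fin m → ℂ) : (charPoly Λ).natDegree = m := by
  rw [charPoly, natDegree_prod_of_monic _ _ fun i _ => monic_X_sub_C _]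
  simp

lemma expDiffOp_cons (c : ℂ) (Λ : Fin m → ℂ) (f : ℝ → ℂ) :
    expDiffOp (Fin.cons c Λ : Fin (m + 1) → ℂ) f =
      fun x => deriv (expDiffOp Λ f) x - c * expDiffOp Λ f x := by
  simp [expDiffOp, List.ofFn_succ]

lemma expDiffOp_eq_aeval (Λ : Fin m → ℂ) (F : smoothFun ℂ) :
    expDiffOp Λ F = aeval derivOp (charPoly Λ) F := by
  induction m with
  | zero => simp [expDiffOp, charPoly]
  | succ m ih =>
    rw [← Fin.cons_self_tail Λ, expDiffOp_cons, charPoly_cons, aeval_X_sub_C_mul_apply', ih]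
    rfl

lemma coe_mem_expPolySpace {F : smoothFun ℂ} :
    (F : ℝ → ℂ) ∈ expPolySpace Λ ↔ aeval derivOp (charPoly Λ) F = 0 := by
  refine (and_iff_right (smoothFun.contDiff F)).trans ?_
  rw [expDiffOp_eq_aeval]
  exact ⟨fun h => Subtype.ext (funext h), fun h x => by rw [h]; rfl⟩

lemma aeval_map_conj_postcomp (P : ℂ[X]) (F : smoothFun ℂ) :
    aeval derivOp (P.map (starRingEnd ℂ)) (postcomp (Complex.conjCLE : ℂ →L[ℝ] ℂ) F) =
      postcomp (Complex.conjCLE : ℂ →L[ℝ] ℂ) (aeval derivOp P F) := by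
  induction P using Polynomial.induction_on' with
  | add P Q hP hQ => simp only [Polynomial.map_add, map_add, LinearMap.add_apply, hP, hQ]
  | monomial n c =>
    rw [map_monomial, aeval_monomial, aeval_monomial, Module.End.mul_apply, Module.End.mul_apply,
      derivOp_pow_postcomp]
    refine Subtype.ext <| funext fun x => ?_
    exact (map_mul (starRingEnd ℂ) c _).symm

lemma map_conj_charPoly (h : ClosedUnderConj (expPolySpace Λ)) :
    (charPoly Λ).map (starRingEnd ℂ) = charPoly Λ := by
  by_contra hne
  have hP₀ : charPoly Λ ≠ 0 := (monic_charPoly Λ).ne_zero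
  have hR₀ : charPoly Λ - (charPoly Λ).map (starRingEnd ℂ) ≠ 0 := sub_ne_zero.2 (Ne.symm hne)
  have hlt : (charPoly Λ - (charPoly Λ).map (starRingEnd ℂ)).degree < (charPoly Λ).degree :=
    degree_sub_lt_left (degree_map _ _).symm hP₀
      (by rw [((monic_charPoly Λ).map _).leadingCoeff, (monic_charPoly Λ).leadingCoeff])
  refine (natDegree_lt_natDegree hR₀ hlt).not_ge <|
    natDegree_le_of_ker_le (IsAlgClosed.splits _) hP₀ (IsAlgClosed.splits _) hR₀ fun F hF => ?_
  set conj := postcomp (Complex.conjCLE : ℂ →L[ℝ] ℂ)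
  have hconj : aeval derivOp (charPoly Λ) (conj F) = 0 :=
    coe_mem_expPolySpace.1 (h F (coe_mem_expPolySpace.2 hF))
  have hF' := aeval_map_conj_postcomp (charPoly Λ) (conj F)
  have hinvol : conj (conj F) = F := Subtype.ext <| funext fun x => Complex.conj_conj _
  rw [hinvol, hconj, map_zero] at hF'
  rw [LinearMap.mem_ker] at hF ⊢
  rw [map_sub, LinearMap.sub_apply, hF, hF', sub_zero]

lemma exists_map_eq_charPoly (h : ClosedUnderConj (expPolySpace Λ)) :
    ∃ Q : ℝ[X], Q.map (algebraMap ℝ ℂ) = charPoly Λ := by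
  refine (mem_lifts _).1 ((lifts_iff_coeff_lifts _).2 fun n => ?_)
  have hn := congrArg (coeff · n) (map_conj_charPoly h)
  simp only [coeff_map] at hn
  exact ⟨_, Complex.conj_eq_iff_re.1 hn⟩

lemma map_X_sub_C_mul {Q : ℝ[X]} (hQ : Q.map (algebraMap ℝ ℂ) = charPoly Λ) (c : ℝ) :
    ((X - C c) * Q).map (algebraMap ℝ ℂ) =
      charPoly (Fin.cons (c : ℂ) Λ : Fin (m + 1) → ℂ) := by
  rw [charPoly_cons, Polynomial.map_mul, hQ]
  simp

lemma natDegree_of_map_eq_charPoly {Q : ℝ[X]} (hQ : Q.map (algebraMap ℝ ℂ) = charPoly Λ) :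
    Q.natDegree = m := by
  rw [← natDegree_map (algebraMap ℝ ℂ), hQ, natDegree_charPoly]

lemma isDisconjugate_of_maxAbsIm_lt {a b : ℝ} {Q : ℝ[X]}
    (hQ : Q.map (algebraMap ℝ ℂ) = charPoly Λ) (hab : a ≤ b)
    (hM : (b - a) * maxAbsIm Λ < Real.pi) : IsDisconjugate a b Q := by
  refine .of_abs_im_mul_lt ((monic_map_iff (f := algebraMap ℝ ℂ)).1 (hQ ▸ monic_charPoly Λ))
    fun z hz => ?_
  rw [← eval_map_algebraMap, hQ, charPoly, eval_prod, Finset.prod_eq_zero_iff] at hz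
  obtain ⟨j, -, hj⟩ := hz
  obtain rfl : z = Λ j := by simpa [sub_eq_zero] using hj
  have hle : |(Λ j).im| ≤ maxAbsIm Λ :=
    le_ciSup (f := fun j => |(Λ j).im|) (Set.finite_range _).bddAbove j
  rw [mul_comm]
  exact (mul_le_mul_of_nonneg_left hle (sub_nonneg.2 hab)).trans_lt hM

end CharPoly

section Bernstein

open smoothFun

variable {𝕜 𝕜' : Type*} [RCLike 𝕜] [RCLike 𝕜'] {a b : ℝ} {P P' : ℝ[X]} {k l : ℕ}
  {F G : smoothFun 𝕜}

namespace IsDisconjugate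

lemma eqOn_zero {f : smoothFun ℝ} (hP : IsDisconjugate a b P) (hkl : k + l = P.natDegree)
    (ha : f ∈ vanishing ℝ k a) (hb : f ∈ vanishing ℝ l b) (hf : aeval derivOp P f = 0) :
    EqOn f 0 (Ioo a b) := by
  intro x hx
  by_contra hne
  obtain ⟨ξ, -, hξ⟩ := hP.exists_mul_mem (K := ConvexCone.strictlyPositive ℝ ℝ) hkl ha hb hx
    (mul_self_pos.2 hne)
  rw [hf] at hξ
  exact (mul_zero (f x * (-1) ^ l)).not_gt hξ

lemma eq_zero_of_real {f : smoothFun ℝ} (hP : IsDisconjugate a b P) (hab : a < b)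
    (hkl : k + l = P.natDegree) (ha : f ∈ vanishing ℝ k a) (hb : f ∈ vanishing ℝ l b)
    (hf : aeval derivOp P f = 0) : f = 0 := by
  obtain ⟨x, hx⟩ := nonempty_Ioo.2 hab
  have hzero : postcomp Complex.ofRealCLM f = 0 := by
    refine eq_zero_of_mem_vanishing (P := P.map (algebraMap ℝ ℂ)) (a := x) (IsAlgClosed.splits _)
      (hP.monic.map _).ne_zero ?_ (postcomp_mem_vanishing _ ?_)
    · rw [aeval_map_algebraMap, aeval_postcomp, hf, map_zero]
    · exact mem_vanishing_of_eqOn_zero isOpen_Ioo (hP.eqOn_zero hkl ha hb hf) hx _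
  exact Subtype.ext <| funext fun y =>
    Complex.ofReal_eq_zero.1 (congrArg (fun G : smoothFun ℂ => G y) hzero)

lemma eq_zero (hP : IsDisconjugate a b P) (hab : a < b) (hkl : k + l = P.natDegree)
    (ha : F ∈ vanishing 𝕜 k a) (hb : F ∈ vanishing 𝕜 l b) (hF : aeval derivOp P F = 0) :
    F = 0 := by
  have hzero (L : 𝕜 →L[ℝ] ℝ) (x : ℝ) : L (F x) = 0 := by
    have h : postcomp L F = 0 := hP.eq_zero_of_real hab hkl (postcomp_mem_vanishing L ha)
      (postcomp_mem_vanishing L hb) (by rw [aeval_postcomp, hF, map_zero])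
    exact congrArg (fun G : smoothFun ℝ => G x) h
  refine Subtype.ext <| funext fun x => RCLike.ext ?_ ?_
  · exact (hzero RCLike.reCLM x).trans (map_zero _).symm
  · exact (hzero RCLike.imCLM x).trans (map_zero _).symm

end IsDisconjugate

/-- `F` is the `k`-th normalized Bernstein function, with respect to `a` and `b`, of the kernel of
`P(d/dx)`; the number `l` of zeros prescribed at `b` is determined by `natDegree_eq`. -/
structure IsBernsteinFun (P : ℝ[X]) (a b : ℝ) (k l : ℕ) (F : smoothFun 𝕜) : Prop where
  natDegree_eq : k + 1 + l = P.natDegree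
  aeval_eq_zero : aeval derivOp P F = 0
  left : F ∈ vanishing 𝕜 k a
  right : F ∈ vanishing 𝕜 l b
  normalized : (derivOp ^ k) F a = 1

namespace IsBernsteinFun

lemma postcomp (hF : IsBernsteinFun P a b k l F) {L : 𝕜 →L[ℝ] 𝕜'} (hL : L 1 = 1) :
    IsBernsteinFun P a b k l (postcomp L F) where
  natDegree_eq := hF.natDegree_eq
  aeval_eq_zero := by rw [aeval_postcomp, hF.aeval_eq_zero, map_zero]
  left := postcomp_mem_vanishing L hF.left
  right := postcomp_mem_vanishing L hF.right
  normalized := by rw [derivOp_pow_postcomp, postcomp_apply, hF.normalized, hL]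

lemma sub_mem_vanishing_left (hF : IsBernsteinFun P a b k l F)
    (hG : IsBernsteinFun P' a b k l G) : F - G ∈ vanishing 𝕜 (k + 1) a := by
  refine mem_vanishing_succ.2 ⟨Submodule.sub_mem _ hF.left hG.left, ?_⟩
  rw [map_sub, Submodule.coe_sub, Pi.sub_apply, hF.normalized, hG.normalized, sub_self]

lemma unique (hP : IsDisconjugate a b P) (hab : a < b) (hF : IsBernsteinFun P a b k l F)
    (hG : IsBernsteinFun P a b k l G) : F = G :=
  sub_eq_zero.1 <| hP.eq_zero hab hF.natDegree_eq (hF.sub_mem_vanishing_left hG)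
    (Submodule.sub_mem _ hF.right hG.right)
    (by rw [map_sub, hF.aeval_eq_zero, hG.aeval_eq_zero, sub_zero])

lemma derivOp_pow_right_ne_zero (hP : IsDisconjugate a b P) (hab : a < b)
    (hF : IsBernsteinFun P a b k l F) : (derivOp ^ l) F b ≠ 0 := by
  intro hzero
  obtain rfl : F = 0 := hP.eq_zero hab (by rw [← hF.natDegree_eq]; ring) hF.left
    (mem_vanishing_succ.2 ⟨hF.right, hzero⟩) hF.aeval_eq_zero
  have hone := hF.normalized
  rw [map_zero] at hone
  exact zero_ne_one hone

lemma exists_complex (hP : IsDisconjugate a b P) (hab : a < b) (hkl : k + 1 + l = P.natDegree) :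
    ∃ F : smoothFun ℂ, IsBernsteinFun P a b k l F := by
  have hcoe (F : smoothFun ℂ) :
      aeval derivOp (P.map (algebraMap ℝ ℂ)) F = aeval derivOp P F := by
    rw [aeval_map_algebraMap]
  obtain ⟨F, hF, hleft, hright⟩ := exists_jet_eq_jet_eq (P := P.map (algebraMap ℝ ℂ))
    (IsAlgClosed.splits _) (hP.monic.map _).ne_zero (by rwa [natDegree_map])
    (fun F hF ha hb => hP.eq_zero hab hkl ha hb (hcoe F ▸ hF))
    (Pi.single (Fin.last k) 1) 0
  refine ⟨F, hkl, hcoe F ▸ hF, mem_vanishing.2 fun j hj => ?_, hright, ?_⟩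
  · exact (congrFun hleft (Fin.castSucc ⟨j, hj⟩)).trans
      (Pi.single_eq_of_ne (Fin.castSucc_lt_last _).ne _)
  · exact (congrFun hleft (Fin.last k)).trans (Pi.single_eq_same _ _)

theorem exists_real (hP : IsDisconjugate a b P) (hab : a < b) (hkl : k + 1 + l = P.natDegree) :
    ∃ f : smoothFun ℝ, IsBernsteinFun P a b k l f := by
  obtain ⟨F, hF⟩ := exists_complex hP hab hkl
  exact ⟨_, hF.postcomp (L := Complex.reCLM) Complex.one_re⟩

end IsBernsteinFun

end Bernstein

section BernsteinBasis

open smoothFun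

variable {m : ℕ} {Λ : Fin (m + 1) → ℂ} {a b : ℝ} {P : ℝ[X]} {p : Fin (m + 1) → ℝ → ℂ}
  {f : Fin (m + 1) → smoothFun ℝ}

lemma aeval_derivOp_of_map_eq (hΛ : P.map (algebraMap ℝ ℂ) = charPoly Λ) (F : smoothFun ℂ) :
    aeval derivOp (charPoly Λ) F = aeval derivOp P F := by
  rw [← hΛ, aeval_map_algebraMap]

lemma IsBernsteinBasis.exists_isBernsteinFun (hΛ : P.map (algebraMap ℝ ℂ) = charPoly Λ)
    (h : IsBernsteinBasis Λ a b p) (k : Fin (m + 1)) :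
    ∃ F : smoothFun ℂ, (F : ℝ → ℂ) = p k ∧ IsBernsteinFun P a b k (m - k) F := by
  obtain ⟨hE, ha, hb, hone⟩ := h k
  let F : smoothFun ℂ := ⟨p k, hE.1⟩
  have hderiv (j : ℕ) : (derivOp ^ j) F = iteratedDeriv j (p k) := derivOp_pow_apply j F
  refine ⟨F, rfl, by rw [natDegree_of_map_eq_charPoly hΛ]; omega, ?_,
    mem_vanishing.2 fun j hj => ?_, mem_vanishing.2 fun j hj => ?_, ?_⟩
  · exact (aeval_derivOp_of_map_eq hΛ F).symm.trans (coe_mem_expPolySpace.1 hE)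
  · exact hderiv j ▸ ha.1 j hj
  · exact hderiv j ▸ hb.1 j hj
  · exact hderiv k ▸ hone

lemma isBernsteinBasis_of_isBernsteinFun (hP : IsDisconjugate a b P) (hab : a < b)
    (hΛ : P.map (algebraMap ℝ ℂ) = charPoly Λ)
    (hf : ∀ k : Fin (m + 1), IsBernsteinFun P a b k (m - k) (f k)) :
    IsBernsteinBasis Λ a b fun k x => (f k x : ℂ) := by
  intro k
  have hF := (hf k).postcomp (L := Complex.ofRealCLM) Complex.ofReal_one
  set F := postcomp Complex.ofRealCLM (f k)
  have hderiv (j : ℕ) : iteratedDeriv j F = (derivOp ^ j) F := (derivOp_pow_apply j F).symm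
  have hone : iteratedDeriv k F a = 1 := hderiv k ▸ hF.normalized
  refine ⟨coe_mem_expPolySpace.2 ((aeval_derivOp_of_map_eq hΛ F).trans hF.aeval_eq_zero),
    ⟨fun j hj => ?_, hone ▸ one_ne_zero⟩, ⟨fun j hj => ?_, ?_⟩, hone⟩
  · exact hderiv j ▸ mem_vanishing.1 hF.left j hj
  · exact hderiv j ▸ mem_vanishing.1 hF.right j hj
  · exact hderiv (m - k) ▸ hF.derivOp_pow_right_ne_zero hP hab

lemma IsBernsteinBasis.eq_ofReal (hP : IsDisconjugate a b P) (hab : a < b)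
    (hΛ : P.map (algebraMap ℝ ℂ) = charPoly Λ) (h : IsBernsteinBasis Λ a b p)
    (hf : ∀ k : Fin (m + 1), IsBernsteinFun P a b k (m - k) (f k)) :
    p = fun k x => (f k x : ℂ) := by
  funext k
  obtain ⟨F, hF, hFB⟩ := h.exists_isBernsteinFun hΛ k
  rw [← hF, hFB.unique hP hab ((hf k).postcomp (L := Complex.ofRealCLM) Complex.ofReal_one)]
  rfl

lemma exists_forall_isBernsteinFun (hP : IsDisconjugate a b P) (hab : a < b)
    (hΛ : P.map (algebraMap ℝ ℂ) = charPoly Λ) :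
    ∃ f : Fin (m + 1) → smoothFun ℝ, ∀ k : Fin (m + 1), IsBernsteinFun P a b k (m - k) (f k) := by
  choose f hf using fun k : Fin (m + 1) => IsBernsteinFun.exists_real (k := k) (l := m - k) hP hab
    (by rw [natDegree_of_map_eq_charPoly hΛ]; omega)
  exact ⟨f, hf⟩

theorem existsUnique_isBernsteinBasis (hP : IsDisconjugate a b P) (hab : a < b)
    (hΛ : P.map (algebraMap ℝ ℂ) = charPoly Λ) : ∃! p, IsBernsteinBasis Λ a b p := by
  obtain ⟨f, hf⟩ := exists_forall_isBernsteinFun hP hab hΛ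
  exact ⟨_, isBernsteinBasis_of_isBernsteinFun hP hab hΛ hf, fun p hp => hp.eq_ofReal hP hab hΛ hf⟩

theorem exists_bernsteinFun_eq_ofReal (hP : IsDisconjugate a b P) (hab : a < b)
    (hΛ : P.map (algebraMap ℝ ℂ) = charPoly Λ) (k : Fin (m + 1)) :
    ∃ f : smoothFun ℝ, IsBernsteinFun P a b k (m - k) f ∧
      bernsteinFun Λ a b k = fun x => (f x : ℂ) := by
  obtain ⟨f, hf⟩ := exists_forall_isBernsteinFun hP hab hΛ
  have h := (existsUnique_isBernsteinBasis hP hab hΛ).exists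
  refine ⟨f k, hf k, ?_⟩
  rw [bernsteinFun, dif_pos h, h.choose_spec.eq_ofReal hP hab hΛ hf]

end BernsteinBasis

section LocalSign

open smoothFun

lemma tendsto_inv_pow_smul_of_mem_vanishing {𝕜 : Type*} [RCLike 𝕜] {F : smoothFun 𝕜} {n : ℕ}
    {b : ℝ} (h : F ∈ vanishing 𝕜 n b) :
    Tendsto (fun x => ((x - b) ^ n)⁻¹ • F x) (𝓝[≠] b)
      (𝓝 ((n.factorial : ℝ)⁻¹ • (derivOp ^ n) F b)) := by
  set v : 𝕜 := (n.factorial : ℝ)⁻¹ • (derivOp ^ n) F b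
  have htaylor (x : ℝ) : taylorWithinEval F n univ b x = (x - b) ^ n • v := by
    rw [taylor_within_apply, Finset.sum_range_succ, Finset.sum_eq_zero, zero_add,
      iteratedDerivWithin_univ, ← derivOp_pow_apply, mul_comm, mul_smul]
    intro j hj
    rw [iteratedDerivWithin_univ, ← derivOp_pow_apply,
      mem_vanishing.1 h j (Finset.mem_range.1 hj), smul_zero]
  have hlittle := taylor_isLittleO (n := n) convex_univ (mem_univ b)
    ((smoothFun.contDiff F).contDiffOn.of_le (by exact_mod_cast le_top))
  simp only [htaylor] at hlittle
  have hremainder :=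
    (hlittle.mono (nhdsWithin_mono b (subset_univ {b}ᶜ))).tendsto_inv_smul_nhds_zero
  have hlim := hremainder.add_const v
  rw [zero_add] at hlim
  refine hlim.congr' ?_
  filter_upwards [self_mem_nhdsWithin] with x hx
  rw [smul_sub, inv_smul_smul₀ (pow_ne_zero n (sub_ne_zero.2 hx)), sub_add_cancel]

variable {f : smoothFun ℝ} {n : ℕ} {a b : ℝ}

lemma eventually_pos_of_derivOp_pow_pos (h : f ∈ vanishing ℝ n b)
    (hpos : 0 < (derivOp ^ n) f b) : ∀ᶠ x in 𝓝[>] b, 0 < f x := by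
  have hlim := (tendsto_inv_pow_smul_of_mem_vanishing h).mono_left
    (nhdsWithin_mono b fun x (hx : x ∈ Ioi b) => hx.ne')
  have hlim_pos : 0 < (n.factorial : ℝ)⁻¹ • (derivOp ^ n) f b := by positivity
  filter_upwards [hlim.eventually_const_lt hlim_pos, self_mem_nhdsWithin] with x hx hbx
  exact (pos_iff_pos_of_mul_pos hx).1 (inv_pos.2 (pow_pos (sub_pos.2 hbx) n))

lemma derivOp_pow_right_nonneg_of_pos (h : f ∈ vanishing ℝ n b) (hab : a < b)
    (hpos : ∀ x ∈ Ioo a b, 0 < f x) : 0 ≤ (-1) ^ n * (derivOp ^ n) f b := by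
  have hlim := ((tendsto_inv_pow_smul_of_mem_vanishing h).mono_left
    (nhdsWithin_mono b fun x (hx : x ∈ Iio b) => hx.ne)).const_mul ((-1 : ℝ) ^ n)
  have hnonneg : 0 ≤ (-1) ^ n * ((n.factorial : ℝ)⁻¹ • (derivOp ^ n) f b) := by
    refine ge_of_tendsto hlim ?_
    filter_upwards [Ioo_mem_nhdsLT hab] with x hx
    have hsign : (-1) ^ n * ((x - b) ^ n)⁻¹ = ((b - x) ^ n)⁻¹ := by
      rw [← neg_sub b x, neg_pow (b - x), mul_inv, ← mul_assoc, mul_inv_cancel₀ (by simp), one_mul]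
    rw [smul_eq_mul, ← mul_assoc, hsign]
    exact mul_nonneg (inv_nonneg.2 (pow_nonneg (sub_pos.2 hx.2).le n)) (hpos x hx).le
  rw [smul_eq_mul, mul_left_comm] at hnonneg
  exact nonneg_of_mul_nonneg_right hnonneg (by positivity)

end LocalSign

section Comparison

open smoothFun

variable {a b c c₀ c₁ x : ℝ} {P Q : ℝ[X]} {k l : ℕ} {f f₀ f₁ : smoothFun ℝ}

namespace IsDisconjugate

lemma X_sub_C_mul (hQ : IsDisconjugate a b Q) (c : ℝ) : IsDisconjugate a b ((X - C c) * Q) :=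
  (X_sub_C c).mul hQ

lemma pos (hP : IsDisconjugate a b P) (hkl : k + l = P.natDegree) (ha : f ∈ vanishing ℝ k a)
    (hb : f ∈ vanishing ℝ l b) (hf : ∀ x ∈ Ioo a b, 0 < (-1) ^ l * aeval derivOp P f x)
    (hx : x ∈ Ioo a b) : 0 < f x := by
  by_contra! hneg
  obtain ⟨ξ, hξ, hmem⟩ := hP.exists_mul_mem (K := ConvexCone.positive ℝ ℝ) (τ := -1) hkl ha hb hx
    (show 0 ≤ -1 * f x by linarith)
  have hnonneg : 0 ≤ -1 * (-1) ^ l * aeval derivOp P f ξ := hmem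
  linarith [hf ξ hξ]

lemma derivOp_pow_right_pos (hP : IsDisconjugate a b P) (hab : a < b)
    (hkl : k + 1 + l = P.natDegree) (ha : f ∈ vanishing ℝ (k + 1) a) (hb : f ∈ vanishing ℝ l b)
    (hf : ∀ x ∈ Ioo a b, 0 < (-1) ^ l * aeval derivOp P f x) :
    0 < (-1) ^ l * (derivOp ^ l) f b := by
  have hpos : ∀ x ∈ Ioo a b, 0 < f x := fun x hx => hP.pos hkl ha hb hf hx
  refine (derivOp_pow_right_nonneg_of_pos hb hab hpos).lt_of_ne' fun hzero => ?_
  obtain ⟨x, hx⟩ := nonempty_Ioo.2 hab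
  -- one more zero at `b` in place of one at `a` flips the sign that `P(d/dx) f` takes somewhere
  obtain ⟨ξ, hξ, hmem⟩ := hP.exists_mul_mem (K := ConvexCone.positive ℝ ℝ) (τ := 1) (k := k)
    (l := l + 1) (by omega) (vanishing_anti k.le_succ ha)
    (mem_vanishing_succ.2 ⟨hb, (mul_eq_zero.1 hzero).resolve_left (by simp)⟩) hx
    (show 0 ≤ 1 * f x by linarith [hpos x hx])
  have hnonneg : 0 ≤ 1 * (-1) ^ (l + 1) * aeval derivOp P f ξ := hmem
  rw [pow_succ] at hnonneg
  linarith [hf ξ hξ]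

end IsDisconjugate

lemma expFun_pos (c x : ℝ) : 0 < expFun c x :=
  (Real.exp_pos (x • c)).trans_eq (congrFun Real.exp_eq_exp_ℝ (x • c))

namespace IsBernsteinFun

lemma natDegree_right (hf : IsBernsteinFun ((X - C c) * Q) a b k l f) :
    k + l = Q.natDegree := by
  have hdeg := hf.natDegree_eq
  obtain rfl | hQ := eq_or_ne Q 0
  · simp at hdeg
  · rw [natDegree_X_sub_C_mul c hQ] at hdeg
    omega

lemma derivOp_aeval_right (hf : IsBernsteinFun ((X - C c) * Q) a b k l f) :
    derivOp (aeval derivOp Q f) = c • aeval derivOp Q f :=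
  sub_eq_zero.1 <| (aeval_X_sub_C_mul_apply' c Q f).symm.trans hf.aeval_eq_zero

lemma aeval_right_pos (hQ : IsDisconjugate a b Q) (hab : a < b)
    (hf : IsBernsteinFun ((X - C c) * Q) a b k l f) (x : ℝ) :
    0 < (-1) ^ l * aeval derivOp Q f x := by
  obtain ⟨y, hy, hfy⟩ := (Filter.Eventually.and (Ioo_mem_nhdsGT hab)
    (eventually_pos_of_derivOp_pow_pos hf.left (hf.normalized ▸ one_pos))).exists
  obtain ⟨ξ, -, hmem⟩ := hQ.exists_mul_mem (K := ConvexCone.strictlyPositive ℝ ℝ) (τ := 1)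
    hf.natDegree_right hf.left hf.right hy (show 0 < 1 * f y by rwa [one_mul])
  have hpos : 0 < 1 * (-1) ^ l * aeval derivOp Q f ξ := hmem
  rw [one_mul] at hpos
  rw [apply_eq_of_derivOp_eq_smul hf.derivOp_aeval_right x ξ, mul_left_comm]
  exact mul_pos (expFun_pos _ _) hpos

lemma pos (hQ : IsDisconjugate a b Q) (hab : a < b)
    (hf : IsBernsteinFun ((X - C c) * Q) a b k l f) (hx : x ∈ Ioo a b) : 0 < f x :=
  hQ.pos hf.natDegree_right hf.left hf.right (fun y _ => hf.aeval_right_pos hQ hab y) hx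

lemma derivOp_pow_right_pos (hQ : IsDisconjugate a b Q) (hab : a < b)
    (hf : IsBernsteinFun ((X - C c) * Q) a b k l f) : 0 < (-1) ^ l * (derivOp ^ l) f b :=
  (derivOp_pow_right_nonneg_of_pos hf.right hab fun _ hx => hf.pos hQ hab hx).lt_of_ne'
    (mul_ne_zero (by simp) (hf.derivOp_pow_right_ne_zero (hQ.X_sub_C_mul c) hab))

lemma aeval_sub_pos (hQ : IsDisconjugate a b Q) (hab : a < b) (hc : c₀ < c₁)
    (h₀ : IsBernsteinFun ((X - C c₀) * Q) a b k l f₀)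
    (h₁ : IsBernsteinFun ((X - C c₁) * Q) a b k l f₁) (x : ℝ) :
    0 < (-1) ^ l * aeval derivOp ((X - C c₀) * Q) (f₁ - f₀) x := by
  have hsub : aeval derivOp ((X - C c₀) * Q) (f₁ - f₀) = (c₁ - c₀) • aeval derivOp Q f₁ := by
    rw [map_sub, h₀.aeval_eq_zero, sub_zero, aeval_X_sub_C_mul_apply', h₁.derivOp_aeval_right]
    exact (sub_smul c₁ c₀ _).symm
  rw [hsub, Submodule.coe_smul, Pi.smul_apply, smul_eq_mul, mul_left_comm]
  exact mul_pos (sub_pos.2 hc) (h₁.aeval_right_pos hQ hab x)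

theorem apply_lt_apply (hQ : IsDisconjugate a b Q) (hab : a < b) (hc : c₀ < c₁)
    (h₀ : IsBernsteinFun ((X - C c₀) * Q) a b k l f₀)
    (h₁ : IsBernsteinFun ((X - C c₁) * Q) a b k l f₁) (hx : x ∈ Ioo a b) : f₀ x < f₁ x :=
  sub_pos.1 <| (hQ.X_sub_C_mul c₀).pos h₀.natDegree_eq (h₁.sub_mem_vanishing_left h₀)
    (Submodule.sub_mem _ h₁.right h₀.right) (fun y _ => aeval_sub_pos hQ hab hc h₀ h₁ y) hx

lemma derivOp_pow_right_lt (hQ : IsDisconjugate a b Q) (hab : a < b) (hc : c₀ < c₁)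
    (h₀ : IsBernsteinFun ((X - C c₀) * Q) a b k l f₀)
    (h₁ : IsBernsteinFun ((X - C c₁) * Q) a b k l f₁) :
    (-1) ^ l * (derivOp ^ l) f₀ b < (-1) ^ l * (derivOp ^ l) f₁ b := by
  have hpos := (hQ.X_sub_C_mul c₀).derivOp_pow_right_pos hab h₀.natDegree_eq
    (h₁.sub_mem_vanishing_left h₀) (Submodule.sub_mem _ h₁.right h₀.right)
    (fun y _ => aeval_sub_pos hQ hab hc h₀ h₁ y)
  rw [map_sub] at hpos
  exact sub_pos.1 (hpos.trans_eq (mul_sub _ _ _))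

theorem exists_tendsto_div_lt_one (hQ : IsDisconjugate a b Q) (hab : a < b) (hc : c₀ < c₁)
    (h₀ : IsBernsteinFun ((X - C c₀) * Q) a b k l f₀)
    (h₁ : IsBernsteinFun ((X - C c₁) * Q) a b k l f₁) :
    ∃ L < 1, Tendsto (fun x => f₀ x / f₁ x) (𝓝[≠] b) (𝓝 L) := by
  have hpos := h₁.derivOp_pow_right_pos hQ hab
  have hsign : ((-1 : ℝ) ^ l) ≠ 0 := by simp
  refine ⟨(derivOp ^ l) f₀ b / (derivOp ^ l) f₁ b, ?_, ?_⟩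
  · rw [← mul_div_mul_left _ _ hsign, div_lt_one hpos]
    exact derivOp_pow_right_lt hQ hab hc h₀ h₁
  · have hfact : ((l.factorial : ℝ)⁻¹) ≠ 0 := by positivity
    have hlim := (tendsto_inv_pow_smul_of_mem_vanishing h₀.right).div
      (tendsto_inv_pow_smul_of_mem_vanishing h₁.right)
      (mul_ne_zero hfact (right_ne_zero_of_mul hpos.ne'))
    simp only [smul_eq_mul, mul_div_mul_left _ _ hfact] at hlim
    refine hlim.congr' ?_
    filter_upwards [self_mem_nhdsWithin] with x hx
    exact mul_div_mul_left _ _ (inv_ne_zero (pow_ne_zero l (sub_ne_zero.2 hx)))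

end IsBernsteinFun

end Comparison

/-- Here `Λ` is the tuple `(λ₂, …, λₙ)` with `m = n - 1 ≥ 0` entries, `Fin.cons μ Λ` is
`(μ, λ₂, …, λₙ)`, and the condition `b - a < π / M` is written as `(b - a) * M < π`, so that it
imposes nothing if `M = 0`. -/
theorem theorem3p6 {m : ℕ} (Λ : Fin m → ℂ) (hΛ : ClosedUnderConj (expPolySpace Λ))
    (a b : ℝ) (hab : 0 < b - a) (hM : (b - a) * maxAbsIm Λ < Real.pi) :
    -- the Bernstein bases exist and are unique
    (∀ μ : ℝ, ∃! p : Fin (m + 1) → ℝ → ℂ,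
      IsBernsteinBasis (Fin.cons (μ : ℂ) Λ : Fin (m + 1) → ℂ) a b p) ∧
    -- the limit of the quotient at `b` exists, is real, and is less than `1`
    (∀ (k : Fin (m + 1)) (l₀ l₁ : ℝ), l₀ < l₁ →
      ∃ L : ℝ, L < 1 ∧
        Filter.Tendsto
          (fun x : ℝ => bernsteinFun (Fin.cons (l₀ : ℂ) Λ : Fin (m + 1) → ℂ) a b k x /
            bernsteinFun (Fin.cons (l₁ : ℂ) Λ : Fin (m + 1) → ℂ) a b k x)
          (𝓝[≠] b) (𝓝 (L : ℂ))) ∧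
    -- the values on `(a, b)` are real and strictly increasing in the real eigenvalue
    (∀ (k : Fin (m + 1)) (x : ℝ), x ∈ Set.Ioo a b →
      (∀ μ : ℝ, (bernsteinFun (Fin.cons (μ : ℂ) Λ : Fin (m + 1) → ℂ) a b k x).im = 0) ∧
      StrictMono
        (fun μ : ℝ => (bernsteinFun (Fin.cons (μ : ℂ) Λ : Fin (m + 1) → ℂ) a b k x).re)) := by
  obtain ⟨Q, hQΛ⟩ := exists_map_eq_charPoly hΛ
  have hab' : a < b := sub_pos.1 hab
  have hQ : IsDisconjugate a b Q := isDisconjugate_of_maxAbsIm_lt hQΛ hab'.le hM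
  choose f hf hfp using fun (c : ℝ) =>
    exists_bernsteinFun_eq_ofReal (hQ.X_sub_C_mul c) hab' (map_X_sub_C_mul hQΛ c)
  simp only [hfp]
  refine ⟨fun μ => existsUnique_isBernsteinBasis (hQ.X_sub_C_mul μ) hab' (map_X_sub_C_mul hQΛ μ),
    fun k l₀ l₁ hl => ?_, fun k x hx => ⟨fun μ => Complex.ofReal_im _, fun l₀ l₁ hl => ?_⟩⟩
  · obtain ⟨L, hL, hlim⟩ := IsBernsteinFun.exists_tendsto_div_lt_one hQ hab' hl (hf l₀ k) (hf l₁ k)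
    exact ⟨L, hL, ((Complex.continuous_ofReal.tendsto L).comp hlim).congr
      fun x => Complex.ofReal_div _ _⟩
  · exact IsBernsteinFun.apply_lt_apply hQ hab' hl (hf l₀ k) (hf l₁ k) hx
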